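/- Let $\ell^2$ be the Hilbert space of square-summable complex sequences indexed by $\{0,1,2,\dots\}$, with standard basis $(e_k)$, and identify a bounded operator $A$ on $\ell^2$ with its matrix, whose entry in row $n$ and column $k$ is $\langle Ae_k,e_n\rangle$. Write $\odot$ for the entrywise product of matrices. Let $\mathcal S_2$ be the set of infinite complex matrices $S$ such that $S\odot A$ is bounded on $\ell^2$ for every bounded $A$, and let $\mathcal S_2^L$ be the set of lower triangular matrices $S$ such that $S\odot A$ is bounded on $\ell^2$ for every bounded lower triangular $A$. A lower triangular matrix $S$ extends to a Schur multiplier in $\mathcal S_2$ if some $T\in\mathcal S_2$ has the same entries as $S$ on and below the main diagonal. Let $a=(a_k)_{k\ge 0}$ be any sequence of complex numbers and let $T_a=(a_{n-k})_{0\le k\le n}$ be the corresponding lower triangular Toeplitz matrix (row $n$, column $k$). Then: 1. $T_a\in\mathcal S_2^L$ if and only if $\tau(z)=\sum_{k\ge 0}a_kz^k$ is the Cauchy transform of a finite complex Borel measure on the unit circle, that is, there is a complex Borel measure $\mu$ on $\mathbb T=\{|\zeta|=1\}$ such that for every $|z|<1$ the series converges and $$\sum_{k\ge 0}a_kz^k=\int_{\mathbb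 T}\frac{d\mu(\zeta)}{1-\bar\zeta z}.$$ 2. If $T_a\in\mathcal S_2^L$, then $T_a$ extends to a Schur multiplier in $\mathcal S_2$. More precisely, for every complex Borel measure $\mu$ on $\mathbb T$ whose Cauchy transform is $\tau$, the Toeplitz matrix $T_\mu=(\hat\mu(n-k))_{n,k\ge 0}$, where $\hat\mu(m)=\int_{\mathbb T}\zeta^{-m}\,d\mu(\zeta)$, belongs to $\mathcal S_2$ and agrees with $T_a$ on and below the main diagonal. -/

import Mathlib

open MeasureTheory
open scoped lp Matrix ComplexConjugate

noncomputable section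

namespace LowerSchur

/-- The unit circle in `ℂ`, with the Borel σ-algebra it inherits from `ℂ`. -/
abbrev UnitCircle : Type := Metric.sphere (0 : ℂ) 1

/-- The infinite matrix `M` (row index first, column index second) belongs to `B(ℓ²)`: it is the
matrix of a bounded operator on `ℓ²(ℕ, ℂ)` with respect to the standard basis, so that `M n k` is
the `n`-th coordinate of the image of the `k`-th basis vector. -/
def IsBounded (M : Matrix ℕ ℕ ℂ) : Prop :=
  ∃ A : ℓ²(ℕ, ℂ) →L[ℂ] ℓ²(ℕ, ℂ), ∀ n k : ℕ, A (lp.single 2 k (1 : ℂ)) n = M n k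

/-- The matrix vanishes above the main diagonal. -/
def IsLowerTriangular (M : Matrix ℕ ℕ ℂ) : Prop :=
  ∀ n k : ℕ, n < k → M n k = 0

/-- The set `𝒮₂` of Schur multipliers of `B(ℓ²)`; `⊙` is the entrywise product. -/
def schurMultipliers : Set (Matrix ℕ ℕ ℂ) :=
  {S | ∀ A : Matrix ℕ ℕ ℂ, IsBounded A → IsBounded (S ⊙ A)}

/-- The set `𝒮₂ᴸ` of lower triangular matrices which are Schur multipliers for the bounded lower
triangular matrices. -/
def lowerSchurMultipliers : Set (Matrix ℕ ℕ ℂ) :=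
  {S | IsLowerTriangular S ∧
    ∀ A : Matrix ℕ ℕ ℂ, IsLowerTriangular A → IsBounded A → IsBounded (S ⊙ A)}

/-- The lower triangular matrix all of whose entries on and below the main diagonal are `1`. -/
def lowerOne : Matrix ℕ ℕ ℂ :=
  Matrix.of fun n k => if k ≤ n then 1 else 0

/-- The lower triangular truncation of a matrix. -/
def lowerTruncation (T : Matrix ℕ ℕ ℂ) : Matrix ℕ ℕ ℂ :=
  T ⊙ lowerOne

/-- `S` is the lower triangular truncation of some Schur multiplier in `𝒮₂`. -/
def ExtendsToSchurMultiplier (S : Matrix ℕ ℕ ℂ) : Prop :=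
  ∃ T ∈ schurMultipliers, lowerTruncation T = S

/-- The lower triangular Toeplitz matrix `(a (n - k))_{0 ≤ k ≤ n}`. -/
def lowerToeplitz (a : ℕ → ℂ) : Matrix ℕ ℕ ℂ :=
  Matrix.of fun n k => if k ≤ n then a (n - k) else 0

/-- The integral `∫ f dμ` of a complex function against a complex Borel measure on the circle. -/
def circleInt (μ : ComplexMeasure UnitCircle) (f : UnitCircle → ℂ) : ℂ :=
  VectorMeasure.integral μ f (ContinuousLinearMap.mul ℝ ℂ)

/-- The Fourier coefficient `∫ ζ⁻ᵐ dμ(ζ)`, for an integer `m`. -/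
def fourierCoefficient (μ : ComplexMeasure UnitCircle) (m : ℤ) : ℂ :=
  circleInt μ fun ζ => (ζ : ℂ) ^ (-m)

/-- The Cauchy transform `z ↦ ∫ (1 - conj ζ * z)⁻¹ dμ(ζ)`, for `z` in the open unit disc. -/
def cauchyTransform (μ : ComplexMeasure UnitCircle) (z : ℂ) : ℂ :=
  circleInt μ fun ζ => 1 / (1 - conj (ζ : ℂ) * z)

/-- The power series `∑ aₖ zᵏ` converges in the open unit disc and its sum there is the Cauchy
transform of `μ`. -/
def IsCauchyTransformOf (a : ℕ → ℂ) (μ : ComplexMeasure UnitCircle) : Prop :=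
  ∀ z : ℂ, ‖z‖ < 1 → HasSum (fun k : ℕ => a k * z ^ k) (cauchyTransform μ z)

/-- The full Toeplitz matrix `(μ̂ (n - k))_{k, n ≥ 0}` of the Fourier coefficients of `μ`. -/
def measureToeplitz (μ : ComplexMeasure UnitCircle) : Matrix ℕ ℕ ℂ :=
  Matrix.of fun n k => fourierCoefficient μ ((n : ℤ) - (k : ℤ))

end LowerSchur

end

/-! Expanding the Cauchy kernel in a geometric series shows that the Cauchy transform of `μ` has
Taylor coefficients `μ̂(k)`, so everything concerns solving `μ̂(k) = a k` for `k ≥ 0`.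

Given such a `μ`, let `D_ζ = diag(ζᵏ)`, which is unitary. Then `T_μ ⊙ A = ∫ D_ζ* A D_ζ dμ(ζ)`, whose
norm is at most `|μ|(𝕋) ‖A‖` (`measureToeplitz_mem_schurMultipliers`). Truncation then gives a lower
triangular multiplier.

Conversely, a lower triangular multiplier satisfies a norm bound by the closed graph theorem
(`exists_bound_schurProduct`). It is tested on Toeplitz operators with symbol `∑ pⱼ ζ⁻ʲ`, whose
norms are controlled by the sup norm of the symbol. The product has symbol `∑ pⱼ aⱼ ζ⁻ʲ`, and its
value at `1` is controlled by the operator norm (`norm_sum_symbol_le`). Hence `p ↦ ∑ pⱼ aⱼ` is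
bounded in the sup norm. Hahn–Banach and Riesz representation (`exists_complexMeasure`) produce `μ`,
which also yields the extension. -/

noncomputable section

namespace LowerSchur

/-! ### Complex measures: finite variation and integrals -/

section VectorMeasure

variable {X : Type*} [MeasurableSpace X]

instance isFiniteMeasure_variation (μ : ComplexMeasure X) : IsFiniteMeasure μ.variation := by
  have h : μ.variation ≤
      (ComplexMeasure.re μ).totalVariation + (ComplexMeasure.im μ).totalVariation := by
    refine VectorMeasure.variation_le_of_forall_enorm_le fun s _ => ?_
    have hre := (ComplexMeasure.re μ).enorm_le_totalVariation s
    have him := (ComplexMeasure.im μ).enorm_le_totalVariation s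
    have hz : ‖μ s‖ₑ ≤ ‖(μ s).re‖ₑ + ‖(μ s).im‖ₑ := by
      simp only [← ofReal_norm]
      rw [← ENNReal.ofReal_add (norm_nonneg _) (norm_nonneg _)]
      exact ENNReal.ofReal_le_ofReal (Complex.norm_le_abs_re_add_abs_im _)
    exact hz.trans (add_le_add hre him)
  exact isFiniteMeasure_of_le _ h

/-- The complex measure `c • m`, for a finite positive measure `m` and a complex number `c`. -/
def complexScale (m : Measure X) [IsFiniteMeasure m] (c : ℂ) : ComplexMeasure X :=
  m.toSignedMeasure.mapRange (ContinuousLinearMap.toSpanSingleton ℝ c : ℝ →+ ℂ)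
    (ContinuousLinearMap.toSpanSingleton ℝ c).continuous

lemma complexScale_apply (m : Measure X) [IsFiniteMeasure m] (c : ℂ) {s : Set X}
    (hs : MeasurableSet s) : complexScale m c s = m.real s • c := by
  change ContinuousLinearMap.toSpanSingleton ℝ c (m.toSignedMeasure s) = _
  rw [Measure.toSignedMeasure_apply_measurable hs, ContinuousLinearMap.toSpanSingleton_apply]

lemma variation_complexScale_le (m : Measure X) [IsFiniteMeasure m] (c : ℂ) :
    (complexScale m c).variation ≤ ‖c‖ₑ • m := by
  refine VectorMeasure.variation_le_of_forall_enorm_le fun s hs => ?_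
  rw [complexScale_apply m c hs, enorm_smul, Measure.smul_apply, smul_eq_mul, mul_comm]
  gcongr
  rw [Real.enorm_of_nonneg measureReal_nonneg, ofReal_measureReal]

lemma integral_complexScale (m : Measure X) [IsFiniteMeasure m] (c : ℂ) {f : X → ℂ}
    (hf : Integrable f m) :
    VectorMeasure.integral (complexScale m c) f (ContinuousLinearMap.mul ℝ ℂ) =
      c * ∫ x, f x ∂m := by
  have hT : DominatedFinMeasAdditive m
      ((complexScale m c).transpose (ContinuousLinearMap.mul ℝ ℂ)) ‖c‖ := by
    refine ⟨(dominatedFinMeasAdditive_cbmApplyMeasure (complexScale m c) _).1.of_eq_top_imp_eq_top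
      ?_, fun s hs _ => ?_⟩
    · intro s _ h
      simp at h
    · have h := norm_cbmApplyMeasure_le (complexScale m c) (ContinuousLinearMap.mul ℝ ℂ) s
      rw [complexScale_apply m c hs] at h
      refine h.trans ?_
      grw [ContinuousLinearMap.opNorm_mul_le]
      simp [mul_comm, abs_of_nonneg measureReal_nonneg]
  have key : setToFun m _ hT f = c * ∫ x, f x ∂m := by
    refine Integrable.induction (μ := m)
      (fun f => setToFun m _ hT f = c * ∫ x, f x ∂m) ?_ ?_ ?_ ?_ hf
    · intro e s hs hms
      rw [setToFun_indicator_const hT hs hms.ne, integral_indicator_const _ hs,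
        transpose_eq_cbmApplyMeasure, cbmApplyMeasure_apply, complexScale_apply m c hs]
      simp only [ContinuousLinearMap.mul_apply', Complex.real_smul]
      ring
    · intro f g _ hf hg h1 h2
      rw [setToFun_add hT hf hg, h1, h2, integral_add' hf hg, mul_add]
    · exact isClosed_eq (continuous_setToFun hT) (continuous_const.mul continuous_integral)
    · intro f g hfg _ h
      rw [← setToFun_congr_ae hT hfg, h, integral_congr_ae hfg]
  rw [← key]
  -- The vector integral extends the set function over its variation, `key` over `m`; domination of
  -- the variation by `‖c‖ₑ • m` makes the two agree.
  exact (setToFun_congr_measure_of_integrable ‖c‖ₑ enorm_ne_top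
    (variation_complexScale_le m c) hT _ f hf).symm

end VectorMeasure

/-! ### Riesz representation on a compact space -/

section Riesz

variable {X : Type*} [TopologicalSpace X] [CompactSpace X]

/-- The upper variation `sup {Λ g | 0 ≤ g ≤ f}` of a functional on `C(X, ℝ)`. -/
def upperVariation (Λ : C(X, ℝ) →L[ℝ] ℝ) (f : C(X, ℝ)) : ℝ :=
  sSup (Λ '' Set.Icc 0 f)

lemma bddAbove_image_Icc (Λ : C(X, ℝ) →L[ℝ] ℝ) (f : C(X, ℝ)) :
    BddAbove (Λ '' Set.Icc 0 f) := by
  refine ⟨‖Λ‖ * ‖f‖, ?_⟩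
  rintro _ ⟨g, ⟨hg0, hgf⟩, rfl⟩
  refine (le_abs_self _).trans ((Λ.le_opNorm g).trans ?_)
  gcongr
  refine (ContinuousMap.norm_le _ (norm_nonneg _)).2 fun x => ?_
  have h0 : 0 ≤ g x := hg0 x
  have h1 : g x ≤ f x := hgf x
  rw [Real.norm_of_nonneg h0]
  exact h1.trans ((le_abs_self _).trans (f.norm_coe_le_norm x))

lemma upperVariation_nonneg (Λ : C(X, ℝ) →L[ℝ] ℝ) {f : C(X, ℝ)} (hf : 0 ≤ f) :
    0 ≤ upperVariation Λ f :=
  le_csSup (bddAbove_image_Icc Λ f) ⟨0, ⟨le_rfl, hf⟩, map_zero Λ⟩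

lemma le_upperVariation (Λ : C(X, ℝ) →L[ℝ] ℝ) {f : C(X, ℝ)} (hf : 0 ≤ f) :
    Λ f ≤ upperVariation Λ f :=
  le_csSup (bddAbove_image_Icc Λ f) ⟨f, ⟨hf, le_rfl⟩, rfl⟩

/-- Riesz decomposition: any `0 ≤ h ≤ f + g` splits into `h ⊓ f ≤ f` and a remainder between `0` and
`g`. -/
lemma upperVariation_add (Λ : C(X, ℝ) →L[ℝ] ℝ) {f g : C(X, ℝ)} (hf : 0 ≤ f) (hg : 0 ≤ g) :
    upperVariation Λ (f + g) = upperVariation Λ f + upperVariation Λ g := by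
  have hne : ∀ {f : C(X, ℝ)}, 0 ≤ f → (Λ '' Set.Icc 0 f).Nonempty :=
    fun h => (Set.nonempty_Icc.2 h).image _
  apply le_antisymm
  · refine csSup_le (hne (add_nonneg hf hg)) ?_
    rintro _ ⟨h, ⟨h0, hfg⟩, rfl⟩
    have hsplit : h = h ⊓ f + (h - h ⊓ f) := by abel
    rw [hsplit, map_add]
    refine add_le_add (le_csSup (bddAbove_image_Icc Λ f) ⟨_, ⟨le_inf h0 hf, inf_le_right⟩, rfl⟩)
      (le_csSup (bddAbove_image_Icc Λ g) ⟨_, ⟨sub_nonneg.2 inf_le_left, ?_⟩, rfl⟩)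
    rw [sub_le_iff_le_add, add_comm g, inf_add]
    exact le_inf (le_add_of_nonneg_right hg) hfg
  · rw [upperVariation, upperVariation,
      ← csSup_add (hne hf) (bddAbove_image_Icc Λ f) (hne hg) (bddAbove_image_Icc Λ g)]
    refine csSup_le ((hne hf).add (hne hg)) ?_
    rintro _ ⟨_, ⟨u, hu, rfl⟩, _, ⟨v, hv, rfl⟩, rfl⟩
    exact le_csSup (bddAbove_image_Icc Λ _)
      ⟨u + v, ⟨add_nonneg hu.1 hv.1, add_le_add hu.2 hv.2⟩, map_add Λ u v⟩

lemma upperVariation_smul_le (Λ : C(X, ℝ) →L[ℝ] ℝ) {c : ℝ} (hc : 0 < c) {f : C(X, ℝ)}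
    (hf : 0 ≤ f) : upperVariation Λ (c • f) ≤ c * upperVariation Λ f := by
  refine csSup_le ((Set.nonempty_Icc.2 (smul_nonneg hc.le hf)).image _) ?_
  rintro _ ⟨g, ⟨hg0, hgf⟩, rfl⟩
  have h : Λ (c⁻¹ • g) ≤ upperVariation Λ f := by
    refine le_csSup (bddAbove_image_Icc Λ f)
      ⟨c⁻¹ • g, ⟨smul_nonneg (inv_nonneg.2 hc.le) hg0, fun x => ?_⟩, rfl⟩
    have h : g x ≤ c * f x := hgf x
    change c⁻¹ * g x ≤ f x
    rwa [inv_mul_le_iff₀ hc]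
  rw [map_smul, smul_eq_mul, inv_mul_le_iff₀ hc] at h
  exact h

lemma upperVariation_smul (Λ : C(X, ℝ) →L[ℝ] ℝ) {c : ℝ} (hc : 0 ≤ c) {f : C(X, ℝ)}
    (hf : 0 ≤ f) : upperVariation Λ (c • f) = c * upperVariation Λ f := by
  rcases hc.eq_or_lt with rfl | hc
  · simp [upperVariation]
  · refine le_antisymm (upperVariation_smul_le Λ hc hf) ?_
    have h := upperVariation_smul_le Λ (inv_pos.2 hc) (smul_nonneg hc.le hf)
    rwa [smul_smul, inv_mul_cancel₀ hc.ne', one_smul, le_inv_mul_iff₀ hc] at h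

variable [T2Space X] [MeasurableSpace X] [BorelSpace X]

/-- Only the cone of nonnegative functions matters, so `q` becomes an `NNReal`-linear functional, to
which Riesz–Markov–Kakutani applies; compact support is automatic. -/
lemma exists_measure_of_cone_functional (q : C(X, ℝ) → ℝ)
    (hpos : ∀ f, 0 ≤ f → 0 ≤ q f)
    (hadd : ∀ f g, 0 ≤ f → 0 ≤ g → q (f + g) = q f + q g)
    (hsmul : ∀ (c : ℝ) f, 0 ≤ c → 0 ≤ f → q (c • f) = c * q f) :
    ∃ m : Measure X, IsFiniteMeasure m ∧ ∀ f : C(X, ℝ), 0 ≤ f → ∫ x, f x ∂m = q f := by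
  let toReal : CompactlySupportedContinuousMap X NNReal → C(X, ℝ) := fun f =>
    ⟨fun x => (f x : ℝ), by fun_prop⟩
  have h0 : ∀ f, 0 ≤ toReal f := fun f x => (f x).2
  let Λ : CompactlySupportedContinuousMap X NNReal →ₗ[NNReal] NNReal :=
    { toFun := fun f => ⟨q (toReal f), hpos _ (h0 f)⟩
      map_add' := fun f g => NNReal.eq (hadd _ _ (h0 f) (h0 g))
      map_smul' := fun c f => NNReal.eq (hsmul c _ c.2 (h0 f)) }
  refine ⟨NNRealRMK.rieszMeasure Λ, ⟨?_⟩, fun f hf => ?_⟩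
  · have h := NNRealRMK.lintegral_rieszMeasure (Λ := Λ)
      (CompactlySupportedContinuousMap.continuousMapEquiv (ContinuousMap.const X 1))
    simp only [CompactlySupportedContinuousMap.continuousMapEquiv_apply_toFun,
      ContinuousMap.const_apply, ENNReal.coe_one, lintegral_one] at h
    rw [h]
    exact ENNReal.coe_lt_top
  · let F : CompactlySupportedContinuousMap X NNReal :=
      CompactlySupportedContinuousMap.continuousMapEquiv
        ⟨fun x => (f x).toNNReal, by fun_prop⟩
    have hF : toReal F = f := by
      ext x
      exact Real.coe_toNNReal _ (hf x)
    have h := NNRealRMK.integral_rieszMeasure (Λ := Λ) F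
    have h' : ((Λ F : NNReal) : ℝ) = q f := by rw [← hF]; rfl
    rw [h'] at h
    rw [← h]
    exact integral_congr_ae (.of_forall fun x => (Real.coe_toNNReal _ (hf x)).symm)

/-- Jordan decomposition: the upper variation and its difference with `Λ` are both positive and
additive on the cone. -/
lemma exists_measure_sub_eq (Λ : C(X, ℝ) →L[ℝ] ℝ) :
    ∃ m₁ m₂ : Measure X, IsFiniteMeasure m₁ ∧ IsFiniteMeasure m₂ ∧
      ∀ f : C(X, ℝ), Λ f = ∫ x, f x ∂m₁ - ∫ x, f x ∂m₂ := by
  obtain ⟨m₁, hm₁, h₁⟩ := exists_measure_of_cone_functional (upperVariation Λ)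
    (fun f hf => upperVariation_nonneg Λ hf) (fun f g hf hg => upperVariation_add Λ hf hg)
    (fun c f hc hf => upperVariation_smul Λ hc hf)
  obtain ⟨m₂, hm₂, h₂⟩ := exists_measure_of_cone_functional (fun f => upperVariation Λ f - Λ f)
    (fun f hf => sub_nonneg.2 (le_upperVariation Λ hf))
    (fun f g hf hg => by rw [upperVariation_add Λ hf hg, map_add]; ring)
    (fun c f hc hf => by rw [upperVariation_smul Λ hc hf, map_smul, smul_eq_mul]; ring)
  refine ⟨m₁, m₂, hm₁, hm₂, fun f => ?_⟩
  have hint : ∀ (m : Measure X) [IsFiniteMeasure m] (g : C(X, ℝ)), Integrable g m :=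
    fun m _ g => g.continuous.integrable_of_hasCompactSupport (HasCompactSupport.of_compactSpace _)
  have hcone : ∀ g : C(X, ℝ), 0 ≤ g → Λ g = ∫ x, g x ∂m₁ - ∫ x, g x ∂m₂ := by
    intro g hg
    rw [h₁ g hg, h₂ g hg]
    ring
  have hf : f = (f ⊔ 0) - ((f ⊔ 0) - f) := by abel
  have e : ∀ m : Measure X, IsFiniteMeasure m →
      ∫ x, f x ∂m = ∫ x, (f ⊔ 0) x ∂m - ∫ x, ((f ⊔ 0) - f) x ∂m := by
    intro m _
    rw [← integral_sub (hint m _) (hint m _)]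
    exact integral_congr_ae (.of_forall fun x => by simp)
  rw [e m₁ hm₁, e m₂ hm₂]
  conv_lhs => rw [hf, map_sub, hcone _ le_sup_right, hcone _ (sub_nonneg.2 le_sup_left)]
  ring

omit [T2Space X] in
lemma integrable_continuousMap (m : Measure X) [IsFiniteMeasure m] (f : C(X, ℂ)) :
    Integrable f m :=
  f.continuous.integrable_of_hasCompactSupport (HasCompactSupport.of_compactSpace _)

/-- **Riesz representation**: a bounded functional on `C(X, ℂ)` is integration against a complex
measure. -/
theorem exists_complexMeasure (Λ : C(X, ℂ) →L[ℂ] ℂ) :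
    ∃ μ : ComplexMeasure X, ∀ f : C(X, ℂ),
      VectorMeasure.integral μ f (ContinuousLinearMap.mul ℝ ℂ) = Λ f := by
  let ι : C(X, ℝ) →L[ℝ] C(X, ℂ) := Complex.ofRealCLM.compLeftContinuous ℝ X
  let Λι : C(X, ℝ) →L[ℝ] ℂ := (Λ.restrictScalars ℝ).comp ι
  obtain ⟨m₁, m₂, hm₁, hm₂, hre⟩ := exists_measure_sub_eq (Complex.reCLM.comp Λι)
  obtain ⟨m₃, m₄, hm₃, hm₄, him⟩ := exists_measure_sub_eq (Complex.imCLM.comp Λι)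
  have hι : ∀ g : C(X, ℝ), Λ (ι g) = ((∫ x, g x ∂m₁ - ∫ x, g x ∂m₂ : ℝ) : ℂ) +
      Complex.I * ((∫ x, g x ∂m₃ - ∫ x, g x ∂m₄ : ℝ) : ℂ) := by
    intro g
    rw [← hre, ← him, mul_comm]
    exact (Complex.re_add_im _).symm
  refine ⟨(complexScale m₁ 1 + complexScale m₂ (-1)) +
    (complexScale m₃ Complex.I + complexScale m₄ (-Complex.I)), fun f => ?_⟩
  have hint : ∀ μ : ComplexMeasure X, μ.Integrable f := fun μ => integrable_continuousMap _ f
  rw [VectorMeasure.integral_add_vectorMeasure (hint _) (hint _),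
    VectorMeasure.integral_add_vectorMeasure (hint _) (hint _),
    VectorMeasure.integral_add_vectorMeasure (hint _) (hint _)]
  rw [integral_complexScale _ _ (integrable_continuousMap _ f),
    integral_complexScale _ _ (integrable_continuousMap _ f),
    integral_complexScale _ _ (integrable_continuousMap _ f),
    integral_complexScale _ _ (integrable_continuousMap _ f)]
  let u : C(X, ℝ) := ⟨fun x => (f x).re, by fun_prop⟩
  let v : C(X, ℝ) := ⟨fun x => (f x).im, by fun_prop⟩
  have hf : f = ι u + Complex.I • ι v := by
    ext x
    simp only [ContinuousMap.add_apply, ContinuousMap.smul_apply, smul_eq_mul]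
    rw [mul_comm]
    exact (Complex.re_add_im (f x)).symm
  have hi : ∀ m : Measure X, IsFiniteMeasure m →
      ∫ x, f x ∂m = ((∫ x, u x ∂m : ℝ) : ℂ) + ((∫ x, v x ∂m : ℝ) : ℂ) * Complex.I := by
    intro m _
    exact (integral_re_add_im (𝕜 := ℂ) (integrable_continuousMap m f)).symm
  conv_rhs => rw [hf, map_add, map_smul, hι, hι, smul_eq_mul]
  rw [hi m₁ hm₁, hi m₂ hm₂, hi m₃ hm₃, hi m₄ hm₄]
  push_cast
  ring

end Riesz

/-! ### Integrals over the circle and Taylor coefficients -/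

section CircleIntegral

variable (μ : ComplexMeasure UnitCircle)

lemma integrable_of_norm_le {f : UnitCircle → ℂ} (hf : StronglyMeasurable f) {C : ℝ}
    (hC : ∀ ζ, ‖f ζ‖ ≤ C) : μ.Integrable f :=
  Integrable.of_bound hf.aestronglyMeasurable C (.of_forall hC)

lemma circleInt_add {f g : UnitCircle → ℂ} (hf : μ.Integrable f) (hg : μ.Integrable g) :
    circleInt μ (fun ζ => f ζ + g ζ) = circleInt μ f + circleInt μ g :=
  VectorMeasure.integral_fun_add hf hg

/-- The integral is built from an `ℝ`-bilinear pairing, so complex homogeneity has to be checked on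
the underlying set function. -/
lemma circleInt_const_mul (c : ℂ) (f : UnitCircle → ℂ) :
    circleInt μ (fun ζ => c * f ζ) = c * circleInt μ f := by
  refine setToFun_smul (𝕜 := ℂ) (dominatedFinMeasAdditive_cbmApplyMeasure μ _) ?_ c f
  intro c s x
  exact mul_assoc c x (μ s)

lemma norm_circleInt_le {f : UnitCircle → ℂ} {C : ℝ} (hC : ∀ ζ, ‖f ζ‖ ≤ C) :
    ‖circleInt μ f‖ ≤ μ.variation.real Set.univ * C := by
  have hC0 : 0 ≤ C := (norm_nonneg _).trans (hC ⟨1, by simp⟩)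
  refine (VectorMeasure.norm_integral_le_of_norm_le_const (.of_forall hC)).trans ?_
  rw [mul_comm]
  gcongr
  exact mul_le_of_le_one_right hC0 (ContinuousLinearMap.opNorm_mul_le _ _)

lemma coe_ne_zero (ζ : UnitCircle) : (ζ : ℂ) ≠ 0 := by
  intro h
  simpa [h] using ζ.2

lemma norm_coe (ζ : UnitCircle) : ‖(ζ : ℂ)‖ = 1 := by simp

lemma conj_coe (ζ : UnitCircle) : conj (ζ : ℂ) = (ζ : ℂ)⁻¹ :=
  (Complex.inv_eq_conj (norm_coe ζ)).symm

lemma hasSum_fourierCoefficient {z : ℂ} (hz : ‖z‖ < 1) :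
    HasSum (fun k : ℕ => fourierCoefficient μ k * z ^ k) (cauchyTransform μ z) := by
  have h : HasSum (fun k : ℕ => circleInt μ fun ζ => z ^ k * (ζ : ℂ) ^ (-(k : ℤ)))
      (cauchyTransform μ z) := by
    refine VectorMeasure.hasSum_integral_of_dominated_convergence (fun k _ => ‖z‖ ^ k)
      ?_ ?_ ?_ ?_ ?_
    · intro k
      have : Continuous fun ζ : UnitCircle => z ^ k * (ζ : ℂ) ^ (-(k : ℤ)) :=
        continuous_const.mul (continuous_subtype_val.zpow₀ _ fun ζ => Or.inl (coe_ne_zero ζ))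
      exact this.aestronglyMeasurable
    · exact fun k => .of_forall fun ζ => by simp
    · exact .of_forall fun _ => summable_geometric_of_lt_one (norm_nonneg _) hz
    · exact integrable_const _
    · refine .of_forall fun ζ => ?_
      have hn : ‖conj (ζ : ℂ) * z‖ < 1 := by simpa using hz
      have := hasSum_geometric_of_norm_lt_one hn
      rw [one_div]
      refine this.congr_fun fun k => ?_
      rw [mul_pow, conj_coe, zpow_neg, zpow_natCast, inv_pow, mul_comm]
  refine h.congr_fun fun k => ?_
  rw [mul_comm]
  exact (circleInt_const_mul μ _ _).symm

lemma isCauchyTransformOf_iff (a : ℕ → ℂ) :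
    IsCauchyTransformOf a μ ↔ ∀ k : ℕ, fourierCoefficient μ k = a k := by
  constructor
  · intro h k
    have hp : ∀ b : ℕ → ℂ, IsCauchyTransformOf b μ →
        HasFPowerSeriesAt (cauchyTransform μ) (FormalMultilinearSeries.ofScalars ℂ b) 0 := by
      intro b hb
      rw [hasFPowerSeriesAt_iff]
      filter_upwards [Metric.ball_mem_nhds (0 : ℂ) one_pos] with z hz
      rw [zero_add]
      refine (hb z (by simpa using hz)).congr_fun fun n => ?_
      simp [FormalMultilinearSeries.coeff_ofScalars, mul_comm]
    have := (hp _ fun z hz => hasSum_fourierCoefficient μ hz).eq_formalMultilinearSeries (hp a h)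
    have := congrArg (fun p => FormalMultilinearSeries.coeff p k) this
    simpa [FormalMultilinearSeries.coeff_ofScalars] using this
  · intro h z hz
    simpa only [h] using hasSum_fourierCoefficient μ hz

end CircleIntegral

/-! ### Schur multiplication by `T_μ` as an average of unitary conjugations -/

section Modulation

/-- The unitary diagonal operator `(xₖ) ↦ (ζᵏ xₖ)` on `ℓ²`. -/
def modulation (ζ : UnitCircle) : ℓ²(ℕ, ℂ) →ₗᵢ[ℂ] ℓ²(ℕ, ℂ) where
  toFun x := ⟨fun k => (ζ : ℂ) ^ k * x k, by
    have h := lp.memℓp x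
    refine (memℓp_gen_iff (by simp)).2 ?_
    simpa using (memℓp_gen_iff (by simp)).1 h⟩
  map_add' x y := by
    ext k
    exact mul_add _ _ _
  map_smul' c x := by
    ext k
    exact mul_left_comm _ _ _
  norm_map' x := by
    simp [lp.norm_eq_tsum_rpow]

lemma modulation_apply (ζ : UnitCircle) (x : ℓ²(ℕ, ℂ)) (k : ℕ) :
    modulation ζ x k = (ζ : ℂ) ^ k * x k := rfl

lemma modulation_single (ζ : UnitCircle) (k : ℕ) :
    modulation ζ (lp.single 2 k (1 : ℂ)) = (ζ : ℂ) ^ k • lp.single 2 k (1 : ℂ) := by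
  ext n
  rw [modulation_apply, lp.coeFn_smul, Pi.smul_apply, smul_eq_mul]
  by_cases h : n = k
  · rw [h]
  · simp [lp.single_apply, h]

/-- Pointwise limit of the finite coordinate sums, which are continuous in `ζ`. -/
lemma stronglyMeasurable_modulation (x : ℓ²(ℕ, ℂ)) :
    StronglyMeasurable fun ζ => modulation ζ x := by
  refine stronglyMeasurable_of_tendsto (f := fun (N : ℕ) (ζ : UnitCircle) =>
    ∑ k ∈ Finset.range N, (ζ : ℂ) ^ k • lp.single 2 k (x k)) Filter.atTop (fun N => ?_) ?_
  · have : Continuous fun ζ : UnitCircle =>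
        ∑ k ∈ Finset.range N, (ζ : ℂ) ^ k • (lp.single 2 k (x k) : ℓ²(ℕ, ℂ)) := by
      fun_prop
    exact this.stronglyMeasurable
  · rw [tendsto_pi_nhds]
    intro ζ
    have h := (lp.hasSum_single (by simp) (modulation ζ x)).tendsto_sum_nat
    refine h.congr fun N => Finset.sum_congr rfl fun k _ => ?_
    rw [modulation_apply, ← smul_eq_mul, lp.single_smul]

variable (A : ℓ²(ℕ, ℂ) →L[ℂ] ℓ²(ℕ, ℂ))

lemma norm_inner_modulation_le (x y : ℓ²(ℕ, ℂ)) (ζ : UnitCircle) :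
    ‖inner ℂ (modulation ζ x) (A (modulation ζ y))‖ ≤ ‖A‖ * ‖x‖ * ‖y‖ := by
  refine (norm_inner_le_norm _ _).trans ?_
  grw [A.le_opNorm]
  simp only [LinearIsometry.norm_map]
  exact le_of_eq (by ring)

variable (μ : ComplexMeasure UnitCircle)

lemma integrable_inner_modulation (x y : ℓ²(ℕ, ℂ)) :
    μ.Integrable fun ζ => inner ℂ (modulation ζ x) (A (modulation ζ y)) :=
  integrable_of_norm_le μ ((stronglyMeasurable_modulation x).inner
    (A.continuous.comp_stronglyMeasurable (stronglyMeasurable_modulation y)))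
    (norm_inner_modulation_le A x y)

/-- The bounded sesquilinear form `(x, y) ↦ ∫ ⟪D_ζ x, A D_ζ y⟫ dμ(ζ)`. -/
def modulationForm : ℓ²(ℕ, ℂ) →L⋆[ℂ] ℓ²(ℕ, ℂ) →L[ℂ] ℂ :=
  LinearMap.mkContinuous₂ (LinearMap.mk₂'ₛₗ (starRingEnd ℂ) (RingHom.id ℂ)
    (fun x y => circleInt μ fun ζ => inner ℂ (modulation ζ x) (A (modulation ζ y)))
    (fun x x' y => by
      simp only [map_add, inner_add_left]
      exact circleInt_add μ (integrable_inner_modulation A μ x y)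
        (integrable_inner_modulation A μ x' y))
    (fun c x y => by
      simp only [map_smul, inner_smul_left]
      exact circleInt_const_mul μ _ _)
    (fun x y y' => by
      simp only [map_add, inner_add_right]
      exact circleInt_add μ (integrable_inner_modulation A μ x y)
        (integrable_inner_modulation A μ x y'))
    (fun c x y => by
      simp only [map_smul, inner_smul_right]
      exact circleInt_const_mul μ _ _))
    (μ.variation.real Set.univ * ‖A‖) (fun x y => by
      refine (norm_circleInt_le μ (norm_inner_modulation_le A x y)).trans ?_
      exact le_of_eq (by ring))

lemma modulationForm_apply (x y : ℓ²(ℕ, ℂ)) :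
    modulationForm A μ x y =
      circleInt μ fun ζ => inner ℂ (modulation ζ x) (A (modulation ζ y)) := rfl

lemma inner_single_one (n : ℕ) (x : ℓ²(ℕ, ℂ)) :
    inner ℂ (lp.single 2 n (1 : ℂ)) x = x n := by
  rw [lp.inner_single_left]
  simp

theorem measureToeplitz_mem_schurMultipliers : measureToeplitz μ ∈ schurMultipliers := by
  rintro M ⟨A, hA⟩
  -- `continuousLinearMapOfBilin` places the operator in the first slot of the inner product; the
  -- adjoint moves it to the second.
  refine ⟨ContinuousLinearMap.adjoint
    (InnerProductSpace.continuousLinearMapOfBilin (modulationForm A μ)), fun n k => ?_⟩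
  rw [← inner_single_one, ContinuousLinearMap.adjoint_inner_right,
    InnerProductSpace.continuousLinearMapOfBilin_apply, modulationForm_apply]
  have h : ∀ ζ : UnitCircle, inner ℂ (modulation ζ (lp.single 2 n (1 : ℂ)))
      (A (modulation ζ (lp.single 2 k (1 : ℂ)))) = M n k * (ζ : ℂ) ^ (-((n : ℤ) - (k : ℤ))) := by
    intro ζ
    rw [modulation_single, modulation_single, map_smul, inner_smul_left, inner_smul_right,
      inner_single_one, hA, map_pow, conj_coe, neg_sub, zpow_sub₀ (coe_ne_zero ζ), zpow_natCast,
      zpow_natCast, inv_pow]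
    ring
  simp only [h]
  rw [circleInt_const_mul, mul_comm]
  rfl

end Modulation

/-! ### Truncation to the lower triangle -/

lemma lowerTruncation_measureToeplitz {a : ℕ → ℂ} {μ : ComplexMeasure UnitCircle}
    (h : IsCauchyTransformOf a μ) : lowerTruncation (measureToeplitz μ) = lowerToeplitz a := by
  rw [isCauchyTransformOf_iff] at h
  ext n k
  by_cases hkn : k ≤ n
  · simp [lowerTruncation, measureToeplitz, lowerToeplitz, lowerOne, hkn, ← h,
      Nat.cast_sub hkn]
  · simp [lowerTruncation, lowerToeplitz, lowerOne, hkn]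

lemma lowerTruncation_mem_lowerSchurMultipliers {T : Matrix ℕ ℕ ℂ} (hT : T ∈ schurMultipliers) :
    lowerTruncation T ∈ lowerSchurMultipliers := by
  refine ⟨fun n k h => by simp [lowerTruncation, lowerOne, h.not_ge], fun A hA hAb => ?_⟩
  have h : lowerTruncation T ⊙ A = T ⊙ A := by
    ext n k
    by_cases hkn : k ≤ n
    · simp [lowerTruncation, lowerOne, hkn]
    · simp [lowerTruncation, lowerOne, hkn, hA n k (not_le.1 hkn)]
  rw [h]
  exact hT A hAb

/-! ### Automatic boundedness of lower triangular multipliers -/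

section ClosedGraph

/-- A diagonal relation between the coordinates of two Banach spaces which is everywhere defined on a
closed subspace is bounded, by the closed graph theorem. -/
lemma exists_bound_of_diagonal {I E F : Type*} [NormedAddCommGroup E] [NormedSpace ℂ E]
    [CompleteSpace E] [NormedAddCommGroup F] [NormedSpace ℂ F] [CompleteSpace F]
    (K : Submodule ℂ E) (hK : IsClosed (K : Set E)) (e : I → E →L[ℂ] ℂ) (f : I → F →L[ℂ] ℂ)
    (hf : ∀ x y, (∀ i, f i x = f i y) → x = y) (s : I → ℂ)
    (hex : ∀ x ∈ K, ∃ y, ∀ i, f i y = s i * e i x) :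
    ∃ C, 0 ≤ C ∧ ∀ x ∈ K, ∀ y, (∀ i, f i y = s i * e i x) → ‖y‖ ≤ C * ‖x‖ := by
  have : CompleteSpace K := hK.completeSpace_coe
  choose φ hφ using fun x : K => hex x x.2
  let Φ : K →ₗ[ℂ] F :=
    { toFun := φ
      map_add' := fun x y => hf _ _ fun i => by
        rw [map_add, hφ, hφ, hφ, Submodule.coe_add, map_add, mul_add]
      map_smul' := fun c x => hf _ _ fun i => by
        rw [RingHom.id_apply, map_smul, hφ, hφ, Submodule.coe_smul, map_smul, smul_eq_mul,
          smul_eq_mul, mul_left_comm] }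
  have hΦ : Continuous Φ := by
    refine Φ.continuous_of_seq_closed_graph fun u x y hu hΦu => hf _ _ fun i => ?_
    have h1 : Filter.Tendsto (fun j => f i (Φ (u j))) Filter.atTop (nhds (f i y)) :=
      ((f i).continuous.tendsto y).comp hΦu
    have h2 : Filter.Tendsto (fun j => s i * e i (u j)) Filter.atTop (nhds (s i * e i x)) :=
      (((e i).continuous.comp continuous_subtype_val).tendsto x |>.comp hu).const_mul _
    refine (tendsto_nhds_unique h1 ?_).trans (hφ x i).symm
    exact h2.congr fun j => (hφ (u j) i).symm
  let Ψ : K →L[ℂ] F := ⟨Φ, hΦ⟩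
  refine ⟨‖Ψ‖, Ψ.opNorm_nonneg, fun x hx y hy => ?_⟩
  have hyx : y = Ψ ⟨x, hx⟩ := hf _ _ fun i => (hy i).trans (hφ ⟨x, hx⟩ i).symm
  rw [hyx]
  exact Ψ.le_opNorm ⟨x, hx⟩

/-- The matrix entry `⟪A eₖ, eₙ⟫` (row `n`, column `k`) as a bounded functional of `A`. -/
def matrixEntry (n k : ℕ) : (ℓ²(ℕ, ℂ) →L[ℂ] ℓ²(ℕ, ℂ)) →L[ℂ] ℂ :=
  (innerSL ℂ (lp.single 2 n (1 : ℂ) : ℓ²(ℕ, ℂ))).comp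
    (ContinuousLinearMap.apply ℂ ℓ²(ℕ, ℂ) (lp.single 2 k (1 : ℂ)))

lemma matrixEntry_apply (n k : ℕ) (A : ℓ²(ℕ, ℂ) →L[ℂ] ℓ²(ℕ, ℂ)) :
    matrixEntry n k A = A (lp.single 2 k (1 : ℂ)) n :=
  inner_single_one n _

lemma ext_matrixEntry {A B : ℓ²(ℕ, ℂ) →L[ℂ] ℓ²(ℕ, ℂ)}
    (h : ∀ n k, matrixEntry n k A = matrixEntry n k B) : A = B := by
  refine lp.ext_continuousLinearMap (by simp) fun k => ?_
  ext n
  have := h n k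
  rw [matrixEntry_apply, matrixEntry_apply] at this
  simpa using this

/-- The closed subspace of lower triangular bounded operators. -/
def lowerOperators : Submodule ℂ (ℓ²(ℕ, ℂ) →L[ℂ] ℓ²(ℕ, ℂ)) :=
  ⨅ (n : ℕ) (k : ℕ) (_ : n < k), LinearMap.ker (matrixEntry n k).toLinearMap

lemma mem_lowerOperators {A : ℓ²(ℕ, ℂ) →L[ℂ] ℓ²(ℕ, ℂ)} :
    A ∈ lowerOperators ↔ ∀ n k, n < k → matrixEntry n k A = 0 := by
  simp [lowerOperators]

lemma isClosed_lowerOperators : IsClosed (lowerOperators : Set (ℓ²(ℕ, ℂ) →L[ℂ] ℓ²(ℕ, ℂ))) := by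
  have h : (lowerOperators : Set (ℓ²(ℕ, ℂ) →L[ℂ] ℓ²(ℕ, ℂ))) =
      ⋂ (n : ℕ) (k : ℕ) (_ : n < k), {A | matrixEntry n k A = 0} := by
    ext A
    simp [mem_lowerOperators]
  rw [h]
  exact isClosed_iInter fun n => isClosed_iInter fun k => isClosed_iInter fun _ =>
    isClosed_eq (matrixEntry n k).continuous continuous_const

lemma exists_schurProduct {S : Matrix ℕ ℕ ℂ} (hS : S ∈ lowerSchurMultipliers)
    {A : ℓ²(ℕ, ℂ) →L[ℂ] ℓ²(ℕ, ℂ)} (hA : A ∈ lowerOperators) :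
    ∃ B : ℓ²(ℕ, ℂ) →L[ℂ] ℓ²(ℕ, ℂ), ∀ n k, matrixEntry n k B = S n k * matrixEntry n k A := by
  obtain ⟨B, hB⟩ := hS.2 (Matrix.of fun n k => matrixEntry n k A) (mem_lowerOperators.1 hA)
    ⟨A, fun n k => (matrixEntry_apply n k A).symm⟩
  exact ⟨B, fun n k => by rw [matrixEntry_apply, hB]; rfl⟩

/-- Schur multiplication is automatically bounded. -/
lemma exists_bound_schurProduct {S : Matrix ℕ ℕ ℂ} (hS : S ∈ lowerSchurMultipliers) :
    ∃ C, 0 ≤ C ∧ ∀ A ∈ lowerOperators, ∀ B : ℓ²(ℕ, ℂ) →L[ℂ] ℓ²(ℕ, ℂ),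
      (∀ n k, matrixEntry n k B = S n k * matrixEntry n k A) → ‖B‖ ≤ C * ‖A‖ := by
  obtain ⟨C, hC, h⟩ := exists_bound_of_diagonal lowerOperators isClosed_lowerOperators
    (fun i : ℕ × ℕ => matrixEntry i.1 i.2) (fun i : ℕ × ℕ => matrixEntry i.1 i.2)
    (fun A B h => ext_matrixEntry fun n k => h (n, k)) (fun i => S i.1 i.2) fun A hA => by
      obtain ⟨B, hB⟩ := exists_schurProduct hS hA
      exact ⟨B, fun i => hB i.1 i.2⟩
  exact ⟨C, hC, fun A hA B hB => h A hA B fun i => hB i.1 i.2⟩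

end ClosedGraph

/-! ### Toeplitz operators and their symbols -/

section Toeplitz

lemma norm_sum_single_one (N : ℕ) :
    ‖∑ k ∈ Finset.range N, (lp.single 2 k (1 : ℂ) : ℓ²(ℕ, ℂ))‖ = √N := by
  have h := lp.norm_sum_single (E := fun _ : ℕ => ℂ) (p := 2) (by simp) (fun _ => 1)
    (Finset.range N)
  simp only [ENNReal.toReal_ofNat, norm_one, Finset.sum_const, Finset.card_range,
    nsmul_eq_mul, Real.rpow_ofNat, one_pow, mul_one] at h
  rw [← h, Real.sqrt_sq (norm_nonneg _)]

/-- The value at `1` of the symbol of a banded lower triangular Toeplitz operator is bounded by the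
norm of the operator. -/
lemma norm_sum_symbol_le {B : ℓ²(ℕ, ℂ) →L[ℂ] ℓ²(ℕ, ℂ)} {q : ℕ → ℂ} {d : ℕ}
    (hB : ∀ n k, matrixEntry n k B = if k ≤ n then q (n - k) else 0)
    (hd : 0 < d) (hq : ∀ j, d ≤ j → q j = 0) :
    ‖∑ j ∈ Finset.range d, q j‖ ≤ 2 * ‖B‖ := by
  set e : ℕ → ℓ²(ℕ, ℂ) := fun k => lp.single 2 k (1 : ℂ)
  -- With `2 * d` rows against `d` columns, no column of the band of width `d` is cut off, so each
  -- contributes the full sum. The factor `2` comes from `√(2d) ≤ 2√d`.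
  have hinner : inner ℂ (∑ n ∈ Finset.range (2 * d), e n) (B (∑ k ∈ Finset.range d, e k)) =
      d * ∑ j ∈ Finset.range d, q j := by
    rw [map_sum, sum_inner]
    simp_rw [inner_sum]
    rw [Finset.sum_comm]
    have hcol : ∀ k ∈ Finset.range d, ∑ n ∈ Finset.range (2 * d), inner ℂ (e n) (B (e k)) =
        ∑ j ∈ Finset.range d, q j := by
      intro k hk
      have hk := Finset.mem_range.1 hk
      have h1 : ∀ n, inner ℂ (e n) (B (e k)) = if k ≤ n then q (n - k) else 0 := fun n => hB n k
      simp_rw [h1]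
      rw [← Finset.sum_filter]
      have h2 : (Finset.range (2 * d)).filter (fun n => k ≤ n) = Finset.Ico k (2 * d) := by
        ext n
        simp [and_comm]
      rw [h2, Finset.sum_Ico_eq_sum_range]
      simp only [Nat.add_sub_cancel_left]
      refine (Finset.sum_subset (Finset.range_subset_range.2 (by omega)) fun j _ hj => ?_).symm
      exact hq j (by simpa using hj)
    rw [Finset.sum_congr rfl hcol]
    simp
  have hbound : d * ‖∑ j ∈ Finset.range d, q j‖ ≤ d * (2 * ‖B‖) := by
    calc d * ‖∑ j ∈ Finset.range d, q j‖
        = ‖inner ℂ (∑ n ∈ Finset.range (2 * d), e n) (B (∑ k ∈ Finset.range d, e k))‖ := by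
          rw [hinner, norm_mul, Complex.norm_natCast]
      _ ≤ ‖∑ n ∈ Finset.range (2 * d), e n‖ * (‖B‖ * ‖∑ k ∈ Finset.range d, e k‖) :=
          (norm_inner_le_norm _ _).trans (by gcongr; exact B.le_opNorm _)
      _ = √((2 * d : ℕ) : ℝ) * (‖B‖ * √d) := by rw [norm_sum_single_one, norm_sum_single_one]
      _ ≤ (2 * √d) * (‖B‖ * √d) := by
          gcongr
          rw [Real.sqrt_le_left (by positivity), mul_pow, Real.sq_sqrt (by positivity)]
          push_cast
          nlinarith [Nat.cast_nonneg (α := ℝ) d]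
      _ = d * (2 * ‖B‖) := by
          have := Real.mul_self_sqrt (Nat.cast_nonneg (α := ℝ) d)
          linear_combination 2 * ‖B‖ * this
  exact le_of_mul_le_mul_left hbound (by exact_mod_cast hd)

open AddCircle

/-- The isometry of `ℓ²` into `L²` of the circle sending `eₖ` to the character `x ↦ exp (-2πikx)`. -/
def hardyEmbedding : ℓ²(ℕ, ℂ) →ₗᵢ[ℂ] Lp ℂ 2 (haarAddCircle (T := (1 : ℝ))) :=
  ((orthonormal_fourier (T := (1 : ℝ))).comp (fun k : ℕ => -(k : ℤ))
    fun i j h => by simpa using h).orthogonalFamily.linearIsometry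

lemma hardyEmbedding_single (k : ℕ) :
    hardyEmbedding (lp.single 2 k (1 : ℂ)) = fourierLp 2 (-(k : ℤ)) := by
  rw [hardyEmbedding, OrthogonalFamily.linearIsometry_apply_single]
  simp

/-- Multiplication by a continuous function on `L²` of the circle. -/
def multiplication : C(UnitAddCircle, ℂ) →L[ℂ]
    (Lp ℂ 2 (haarAddCircle (T := (1 : ℝ))) →L[ℂ] Lp ℂ 2 (haarAddCircle (T := (1 : ℝ)))) :=
  ((ContinuousLinearMap.mul ℂ ℂ).holderL haarAddCircle ⊤ 2 2).comp
    (ContinuousMap.toLp ⊤ haarAddCircle ℂ)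

lemma multiplication_fourier (i j : ℤ) :
    multiplication (fourier i) (fourierLp 2 j) = fourierLp 2 (i + j) := by
  refine Lp.ext ?_
  change (ContinuousLinearMap.mul ℂ ℂ).holder 2 (ContinuousMap.toLp ⊤ haarAddCircle ℂ (fourier i))
    (fourierLp 2 j) =ᵐ[_] _
  filter_upwards [(ContinuousLinearMap.mul ℂ ℂ).coeFn_holder (r := 2)
    (ContinuousMap.toLp ⊤ haarAddCircle ℂ (fourier i)) (fourierLp 2 j),
    ContinuousMap.coeFn_toLp (p := ⊤) (𝕜 := ℂ) haarAddCircle (fourier (T := (1 : ℝ)) i),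
    coeFn_fourierLp (T := (1 : ℝ)) 2 j, coeFn_fourierLp (T := (1 : ℝ)) 2 (i + j)]
    with x h1 h2 h3 h4
  rw [h1, h2, h3, h4, fourier_add]
  rfl

/-- The Toeplitz operator on `ℓ²` whose symbol is a continuous function on the circle. -/
def toeplitzOperator : C(UnitAddCircle, ℂ) →L[ℂ] (ℓ²(ℕ, ℂ) →L[ℂ] ℓ²(ℕ, ℂ)) :=
  (ContinuousLinearMap.compL ℂ _ _ _
    (ContinuousLinearMap.adjoint hardyEmbedding.toContinuousLinearMap)).comp
  (((ContinuousLinearMap.compL ℂ _ _ _).flip hardyEmbedding.toContinuousLinearMap).comp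
    multiplication)

lemma matrixEntry_toeplitzOperator (g : C(UnitAddCircle, ℂ)) (n k : ℕ) :
    matrixEntry n k (toeplitzOperator g) =
      inner ℂ (fourierLp (T := (1 : ℝ)) 2 (-(n : ℤ))) (multiplication g (fourierLp 2 (-(k : ℤ)))) := by
  rw [← hardyEmbedding_single, ← hardyEmbedding_single]
  exact ContinuousLinearMap.adjoint_inner_right hardyEmbedding.toContinuousLinearMap _ _

lemma matrixEntry_toeplitzOperator_fourier (j n k : ℕ) :
    matrixEntry n k (toeplitzOperator (fourier (-(j : ℤ)))) = if n = j + k then 1 else 0 := by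
  rw [matrixEntry_toeplitzOperator, multiplication_fourier,
    orthonormal_iff_ite.1 (orthonormal_fourier (T := (1 : ℝ)))]
  congr 1
  simp only [eq_iff_iff]
  omega

lemma matrixEntry_toeplitzOperator_linearCombination (p : ℕ →₀ ℂ) (n k : ℕ) :
    matrixEntry n k (toeplitzOperator
      (Finsupp.linearCombination ℂ (fun j : ℕ => fourier (-(j : ℤ))) p)) =
      if k ≤ n then p (n - k) else 0 := by
  induction p using Finsupp.induction_linear with
  | zero => simp
  | add p q hp hq =>
    rw [map_add, map_add, map_add, hp, hq]
    split_ifs <;> simp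
  | single j c =>
    rw [Finsupp.linearCombination_single, map_smul, map_smul, matrixEntry_toeplitzOperator_fourier,
      Finsupp.single_apply, smul_eq_mul, mul_ite, mul_one, mul_zero]
    split_ifs <;> first | rfl | omega

/-- The continuous function `ζ ↦ ζ⁻ʲ` on the circle. -/
def invPow (j : ℕ) : C(UnitCircle, ℂ) where
  toFun ζ := (ζ : ℂ) ^ (-(j : ℤ))
  continuous_toFun := continuous_subtype_val.zpow₀ _ fun ζ => Or.inl (coe_ne_zero ζ)

/-- Passes between two models of the circle: `UnitAddCircle` carries the Fourier basis, `UnitCircle`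
the measures. -/
lemma norm_linearCombination_fourier_le (p : ℕ →₀ ℂ) :
    ‖Finsupp.linearCombination ℂ (fun j : ℕ => fourier (T := (1 : ℝ)) (-(j : ℤ))) p‖ ≤
      ‖Finsupp.linearCombination ℂ invPow p‖ := by
  let φ : UnitAddCircle → UnitCircle := fun x => ⟨(toCircle x : ℂ), mem_sphere_zero_iff_norm.2 (Circle.norm_coe _)⟩
  have h : ∀ x, Finsupp.linearCombination ℂ (fun j : ℕ => fourier (T := (1 : ℝ)) (-(j : ℤ))) p x =
      Finsupp.linearCombination ℂ invPow p (φ x) := by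
    intro x
    induction p using Finsupp.induction_linear with
    | zero => simp
    | add p q hp hq => simp only [map_add, ContinuousMap.add_apply, hp, hq]
    | single j c =>
      simp only [Finsupp.linearCombination_single, ContinuousMap.smul_apply]
      congr 1
      rw [fourier_apply, toCircle_zsmul, Circle.coe_zpow]
      rfl
  refine (ContinuousMap.norm_le _ (norm_nonneg _)).2 fun x => ?_
  rw [h]
  exact ContinuousMap.norm_coe_le_norm _ _

end Toeplitz

/-! ### From the multiplier bound to the measure -/

/-- A functional bounded with respect to a linear map factors through it continuously. -/
lemma exists_continuous_factorization {V E : Type*} [AddCommGroup V] [Module ℂ V]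
    [NormedAddCommGroup E] [NormedSpace ℂ E] (ι : V →ₗ[ℂ] E) (f : V →ₗ[ℂ] ℂ) {C : ℝ}
    (hC : ∀ v, ‖f v‖ ≤ C * ‖ι v‖) : ∃ Λ : E →L[ℂ] ℂ, ∀ v, Λ (ι v) = f v := by
  obtain ⟨s, hs⟩ := ι.rangeRestrict.exists_rightInverse_of_surjective ι.range_rangeRestrict
  have hιs : ∀ w : LinearMap.range ι, ι (s w) = w := fun w =>
    congrArg Subtype.val (LinearMap.congr_fun hs w)
  obtain ⟨Λ, hΛ, -⟩ := exists_extension_norm_eq (LinearMap.range ι)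
    ((f.comp s).mkContinuous C fun w => by simpa [hιs] using hC (s w))
  refine ⟨Λ, fun v => ?_⟩
  have h1 : Λ (ι v) = f (s (ι.rangeRestrict v)) := hΛ (ι.rangeRestrict v)
  -- The difference lies in the kernel of `ι`, where the bound forces `f` to vanish.
  have h2 : f (s (ι.rangeRestrict v) - v) = 0 := by
    refine norm_le_zero_iff.1 ((hC _).trans (le_of_eq ?_))
    rw [map_sub, hιs]
    simp
  rw [h1, ← sub_eq_zero, ← map_sub, h2]

theorem exists_isCauchyTransformOf {a : ℕ → ℂ} (ha : lowerToeplitz a ∈ lowerSchurMultipliers) :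
    ∃ μ : ComplexMeasure UnitCircle, IsCauchyTransformOf a μ := by
  obtain ⟨C, hC, hbd⟩ := exists_bound_schurProduct ha
  have hbound : ∀ p : ℕ →₀ ℂ, ‖Finsupp.linearCombination ℂ a p‖ ≤
      2 * (C * ‖toeplitzOperator‖) * ‖Finsupp.linearCombination ℂ invPow p‖ := by
    intro p
    let g : C(UnitAddCircle, ℂ) :=
      Finsupp.linearCombination ℂ (fun j : ℕ => fourier (-(j : ℤ))) p
    have hA : toeplitzOperator g ∈ lowerOperators := mem_lowerOperators.2 fun n k h => by
      rw [matrixEntry_toeplitzOperator_linearCombination, if_neg h.not_ge]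
    obtain ⟨B, hB⟩ := exists_schurProduct ha hA
    have hentry : ∀ n k, matrixEntry n k B = if k ≤ n then p (n - k) * a (n - k) else 0 := by
      intro n k
      rw [hB, matrixEntry_toeplitzOperator_linearCombination]
      by_cases h : k ≤ n <;> simp [lowerToeplitz, h, mul_comm]
    obtain ⟨d, hd⟩ := p.support.exists_nat_subset_range
    -- The bandwidth is `d + 1` rather than `d`, since it must be positive even when `p = 0`.
    have hp : ∀ j, d + 1 ≤ j → p j * a j = 0 := by
      intro j hj
      have : j ∉ p.support := fun h => by
        have := Finset.mem_range.1 (hd h)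
        omega
      rw [Finsupp.notMem_support_iff.1 this, zero_mul]
    have hsum : Finsupp.linearCombination ℂ a p = ∑ j ∈ Finset.range (d + 1), p j * a j := by
      rw [Finsupp.linearCombination_apply]
      refine Finsupp.sum_of_support_subset _
        (hd.trans (Finset.range_subset_range.2 d.le_succ)) _ (by simp)
    calc ‖Finsupp.linearCombination ℂ a p‖
        ≤ 2 * ‖B‖ := hsum ▸ norm_sum_symbol_le hentry d.succ_pos hp
      _ ≤ 2 * (C * (‖toeplitzOperator‖ * ‖g‖)) := by
          gcongr
          exact (hbd _ hA B hB).trans (by gcongr; exact toeplitzOperator.le_opNorm g)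
      _ ≤ 2 * (C * (‖toeplitzOperator‖ * ‖Finsupp.linearCombination ℂ invPow p‖)) := by
          gcongr
          exact norm_linearCombination_fourier_le p
      _ = _ := by ring
  obtain ⟨Λ, hΛ⟩ := exists_continuous_factorization _ _ hbound
  obtain ⟨μ, hμ⟩ := exists_complexMeasure Λ
  refine ⟨μ, (isCauchyTransformOf_iff μ a).2 fun k => (hμ (invPow k)).trans ?_⟩
  simpa using hΛ (Finsupp.single k 1)

end LowerSchur

end

theorem proposition2p6 (a : ℕ → ℂ) :
    (LowerSchur.lowerToeplitz a ∈ LowerSchur.lowerSchurMultipliers ↔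
      ∃ μ : ComplexMeasure LowerSchur.UnitCircle, LowerSchur.IsCauchyTransformOf a μ) ∧
    (LowerSchur.lowerToeplitz a ∈ LowerSchur.lowerSchurMultipliers →
      LowerSchur.ExtendsToSchurMultiplier (LowerSchur.lowerToeplitz a)) ∧
    (∀ μ : ComplexMeasure LowerSchur.UnitCircle, LowerSchur.IsCauchyTransformOf a μ →
      LowerSchur.measureToeplitz μ ∈ LowerSchur.schurMultipliers ∧
        LowerSchur.lowerTruncation (LowerSchur.measureToeplitz μ) = LowerSchur.lowerToeplitz a) := by
  have hext : ∀ μ : ComplexMeasure LowerSchur.UnitCircle, LowerSchur.IsCauchyTransformOf a μ →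
      LowerSchur.measureToeplitz μ ∈ LowerSchur.schurMultipliers ∧
        LowerSchur.lowerTruncation (LowerSchur.measureToeplitz μ) = LowerSchur.lowerToeplitz a :=
    fun μ hμ => ⟨LowerSchur.measureToeplitz_mem_schurMultipliers μ,
      LowerSchur.lowerTruncation_measureToeplitz hμ⟩
  refine ⟨⟨LowerSchur.exists_isCauchyTransformOf, ?_⟩, fun h => ?_, hext⟩
  · rintro ⟨μ, hμ⟩
    rw [← (hext μ hμ).2]
    exact LowerSchur.lowerTruncation_mem_lowerSchurMultipliers (hext μ hμ).1
  · obtain ⟨μ, hμ⟩ := LowerSchur.exists_isCauchyTransformOf h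
    exact ⟨LowerSchur.measureToeplitz μ, hext μ hμ⟩
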